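/- Let $V\subset H=H'\subset V'$ be a Gelfand triple of real Hilbert spaces (of the embedding $V\subset H$ only continuity is used, not density), let $T_{\rm end}>0$, $f\in H$, $u_0\in V$, and let $a:V\times V\to\mathbb R$ be a continuous and coercive bilinear form. Write $(\cdot,\cdot)$ and $\|\cdot\|$ for the inner product and norm of $H$. Let $u\in L^2(0,T_{\rm end};V)$ with $\partial_t u\in L^2(0,T_{\rm end};V')$ be the solution of $$u(0)=u_0,\qquad \langle\partial_t u(t),v\rangle+a(u(t),v)=(f,v)\quad\text{for all }v\in V\text{ and a.e. }t\in(0,T_{\rm end}).$$ Let $\widetilde V\subset H$ be a finite-dimensional subspace, not necessarily contained in $V$, let $a_h:(V+\widetilde V)\times(V+\widetilde V)\to\mathbb R$ be a bilinear form that coincides with $a$ on $V\times V$, and let $|||\cdot|||$ be a norm on $V+\widetilde V$ with $|||v|||=a_h(v,v)^{1/2}$ for all $v\in V$. Define $$\gamma_h:=\inf\{c\ge 0: |a_h(v,w)|\le c\,|||v|||\,|||w|||\ \ \forall v,w\in V\},\qquad C_{H,V}^b:=\inf\{c\ge 0:\|v\|\le c\,|||v|||\ \ \forall v\in V\},$$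 and, for $h\in H$, $|||h|||_{V,-1}:=\sup_{0\ne v\in V}(h,v)/|||v|||$ (with value $0$ if $V=\{0\}$). For $\tilde v\in\widetilde V$ let $A_h(\tilde v)\in\widetilde V$ be given by $(A_h(\tilde v),\tilde v')=a_h(\tilde v,\tilde v')$ for all $\tilde v'\in\widetilde V$, let $\widetilde\Pi$ be the $H$-orthogonal projection onto $\widetilde V$, and let the elliptic reconstruction $\mathcal R_{\rm ell}(\tilde v)\in V$ be the unique solution of $$a_h(\mathcal R_{\rm ell}(\tilde v),v)=(A_h(\tilde v)-\widetilde\Pi f+f,\,v)\quad\text{for all }v\in V.$$ Let $\tilde u\in L^2(0,T_{\rm end};\widetilde V)$ with $\partial_t\tilde u\in L^2(0,T_{\rm end};\widetilde V)$ be arbitrary; it need not satisfy any discrete equation. Let $\tilde u(t)=\tilde u^c(t)+\tilde u^d(t)$ for a.e. $t$, with $\tilde u^c(t)\in V$, $\tilde u^d(t)\in\widetilde V$ and $\tilde u^d,\partial_t\tilde u^d\in L^2(0,T_{\rm end};\widetilde V)$. Let $\mathcal R_T[\tilde u](t)\in\widetilde V$ be the Riesz representative of the time-stepping residual, $$(\mathcal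 R_T[\tilde u](t),\tilde v)=(\partial_t\tilde u(t),\tilde v)+a_h(\tilde u(t),\tilde v)-(f,\tilde v)\quad\text{for all }\tilde v\in\widetilde V,$$ and put $e:=u-\tilde u$, $e^c:=u-\tilde u^c$, $\varepsilon:=\mathcal R_{\rm ell}(\tilde u)-\tilde u$. Then, with $C:=(3\gamma_h^2+2)^{1/2}$, all norms below are finite, $e^c$ has a representative in $C([0,T_{\rm end}];H)$, whose value at $0$ is denoted $e^c(0)$, and $$\begin{aligned}\|e\|_{L^2(0,T_{\rm end};|||\cdot|||)}\le{}&\|e^c(0)\|+2\,\|\partial_t\tilde u^d\|_{L^2(0,T_{\rm end};|||\cdot|||_{V,-1})}+(C+1)\,\|\varepsilon\|_{L^2(0,T_{\rm end};|||\cdot|||)}\\&+C\,\|\tilde u^d\|_{L^2(0,T_{\rm end};|||\cdot|||)}+2\,C_{H,V}^b\,\|\mathcal R_T[\tilde u]\|_{L^2(0,T_{\rm end};H)}.\end{aligned}$$ Here initial values ($u(0)$ and $e^c(0)$) are those of the representatives in $C([0,T_{\rm end}];H)$. -/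

import Mathlib

open MeasureTheory Set
open scoped ContDiff ENNReal InnerProductSpace

noncomputable section

namespace ParabolicEstimate

/-! ### Functions of time on `(0, T)` -/

section Time

variable {E : Type*} [NormedAddCommGroup E] [NormedSpace ℝ E]

/-- Lebesgue measure on the time interval `(0, T)`. -/
abbrev timeMeasure (T : ℝ) : Measure ℝ := volume.restrict (Ioo 0 T)

/-- `g'` is the weak (distributional) derivative of `g` on `(0, T)`, tested with
`φ ∈ C_c^∞((0, T))`. -/
def IsWeakDeriv (T : ℝ) (g g' : ℝ → E) : Prop :=
  ∀ φ : ℝ → ℝ, ContDiff ℝ ∞ φ → HasCompactSupport φ → tsupport φ ⊆ Ioo 0 T →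
    ∫ t in Ioo 0 T, deriv φ t • g t = -∫ t in Ioo 0 T, φ t • g' t

/-- `g ∈ L²(0, T; E)` and `∂ₜ g = g' ∈ L²(0, T; E)`. -/
structure IsH1 (T : ℝ) (g g' : ℝ → E) : Prop where
  memLp : MemLp g 2 (timeMeasure T)
  memLp_deriv : MemLp g' 2 (timeMeasure T)
  isWeakDeriv : IsWeakDeriv T g g'

/-- `g(0) = x` for an almost everywhere defined function `g` of time: the representative of `g`
in `C([0, T]; E)` takes the value `x` at time `0`.  (For `0 < T` there is at most one such `x`.) -/
def HasInitialValue (T : ℝ) (g : ℝ → E) (x : E) : Prop :=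
  ∃ w : ℝ → E, ContinuousOn w (Icc 0 T) ∧ w =ᵐ[timeMeasure T] g ∧ w 0 = x

/-- The `L²(0, T)`-norm of a scalar function of time. -/
def l2Norm (T : ℝ) (g : ℝ → ℝ) : ℝ≥0∞ := eLpNorm g 2 (timeMeasure T)

end Time

/-! ### The spaces `V ⊆ H ⊆ V'` and the finite dimensional space `Ṽ ⊆ H`

`V` is a Hilbert space, and its embedding into `H` is the continuous injective linear map `ι`.
Density of `V` in `H` is not required; so `V` may also be a discretized space. -/

section Spaces

variable {H V : Type*} [NormedAddCommGroup H] [InnerProductSpace ℝ H] [CompleteSpace H]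
  [NormedAddCommGroup V] [InnerProductSpace ℝ V] [CompleteSpace V]

/-- The map `H → V'` of the Gelfand triple, `h ↦ (h, ·)_H`. -/
def toDualV (ι : V →L[ℝ] H) (h : H) : StrongDual ℝ V := (innerSL ℝ h).comp ι

/-- The weak solution of the parabolic problem: `u ∈ L²(0, T; V)`, `∂ₜ u ∈ L²(0, T; V')`,
`u(0) = u₀`, and `⟨∂ₜ u(t), v⟩ + a(u(t), v) = (f, v)` for all `v ∈ V` and almost every `t`. -/
structure IsParabolicSolution (ι : V →L[ℝ] H) (a : V →L[ℝ] V →L[ℝ] ℝ) (f : H) (u₀ : V) (T : ℝ)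
    (u : ℝ → V) : Prop where
  memLp : MemLp u 2 (timeMeasure T)
  initial : HasInitialValue T (fun t => ι (u t)) (ι u₀)
  equation : ∃ u' : ℝ → StrongDual ℝ V, MemLp u' 2 (timeMeasure T) ∧
    IsWeakDeriv T (fun t => toDualV ι (ι (u t))) u' ∧
    ∀ᵐ t ∂timeMeasure T, ∀ v : V, u' t v + a (u t) v = ⟪f, ι v⟫_ℝ

/-- The space `V + Ṽ`, as a subspace of `H`. -/
abbrev sumSpace (ι : V →L[ℝ] H) (Vt : Submodule ℝ H) : Submodule ℝ H :=
  LinearMap.range (ι : V →ₗ[ℝ] H) ⊔ Vt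

/-- The inclusion `V → V + Ṽ`. -/
def inclV (ι : V →L[ℝ] H) (Vt : Submodule ℝ H) : V →ₗ[ℝ] sumSpace ι Vt :=
  (Submodule.inclusion le_sup_left).comp (LinearMap.rangeRestrict (ι : V →ₗ[ℝ] H))

/-- The inclusion `Ṽ → V + Ṽ`. -/
def inclVt (ι : V →L[ℝ] H) (Vt : Submodule ℝ H) : Vt →ₗ[ℝ] sumSpace ι Vt :=
  Submodule.inclusion le_sup_right

/-- The Riesz representative in `Ṽ`, with respect to the `H`-inner product, of a linear
functional on the finite dimensional space `Ṽ`. -/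
def rieszRep (Vt : Submodule ℝ H) [FiniteDimensional ℝ Vt] (l : Vt →ₗ[ℝ] ℝ) : Vt :=
  (InnerProductSpace.toDual ℝ Vt).symm (LinearMap.toContinuousLinearMap l)

theorem inner_rieszRep (Vt : Submodule ℝ H) [FiniteDimensional ℝ Vt] (l : Vt →ₗ[ℝ] ℝ) (w : Vt) :
    ⟪(rieszRep Vt l : H), (w : H)⟫_ℝ = l w := by
  rw [← Submodule.coe_inner, rieszRep, InnerProductSpace.toDual_symm_apply]
  rfl

/-- `A_h(ṽ) ∈ Ṽ`, the Riesz representative of `a_h(ṽ, ·)`. -/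
def discreteOp (ι : V →L[ℝ] H) (Vt : Submodule ℝ H) [FiniteDimensional ℝ Vt]
    (ah : sumSpace ι Vt →ₗ[ℝ] sumSpace ι Vt →ₗ[ℝ] ℝ) (vt : Vt) : Vt :=
  rieszRep Vt ((ah (inclVt ι Vt vt)).comp (inclVt ι Vt))

/-- The value at one time of the Riesz representative `R_T[ũ] ∈ Ṽ` of the time-stepping residual
`ṽ ↦ (∂ₜ ũ, ṽ) + a_h(ũ, ṽ) - (f, ṽ)`, as a function of the values of `ũ` and `∂ₜ ũ`. -/
def timeResidual (ι : V →L[ℝ] H) (Vt : Submodule ℝ H) [FiniteDimensional ℝ Vt]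
    (ah : sumSpace ι Vt →ₗ[ℝ] sumSpace ι Vt →ₗ[ℝ] ℝ) (f : H) (ut ut' : Vt) : Vt :=
  rieszRep Vt
    ((innerₛₗ ℝ (ut' : H)).comp Vt.subtype + (ah (inclVt ι Vt ut)).comp (inclVt ι Vt)
      - (innerₛₗ ℝ f).comp Vt.subtype)

theorem inner_timeResidual (ι : V →L[ℝ] H) (Vt : Submodule ℝ H) [FiniteDimensional ℝ Vt]
    (ah : sumSpace ι Vt →ₗ[ℝ] sumSpace ι Vt →ₗ[ℝ] ℝ) (f : H) (ut ut' w : Vt) :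
    ⟪(timeResidual ι Vt ah f ut ut' : H), (w : H)⟫_ℝ
      = ⟪(ut' : H), (w : H)⟫_ℝ + ah (inclVt ι Vt ut) (inclVt ι Vt w) - ⟪f, (w : H)⟫_ℝ := by
  rw [timeResidual, inner_rieszRep]
  simp

/-- The elliptic reconstruction `R_ell(ṽ) ∈ V`: the unique solution (by the theorem of Lax and
Milgram) of `a(R_ell(ṽ), v) = (A_h(ṽ) - Π̃ f + f, v)` for all `v ∈ V`, where `Π̃` is the
`H`-orthogonal projection onto `Ṽ`; see `ellipticReconstruction_iff`. -/
def ellipticReconstruction (ι : V →L[ℝ] H) (Vt : Submodule ℝ H) [FiniteDimensional ℝ Vt]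
    {a : V →L[ℝ] V →L[ℝ] ℝ} (ha : IsCoercive a)
    (ah : sumSpace ι Vt →ₗ[ℝ] sumSpace ι Vt →ₗ[ℝ] ℝ) (f : H) (vt : Vt) : V :=
  ha.continuousLinearEquivOfBilin.symm
    (ContinuousLinearMap.adjoint ι
      ((discreteOp ι Vt ah vt : H) - (Vt.orthogonalProjectionOnto f : H) + f))

theorem ellipticReconstruction_iff (ι : V →L[ℝ] H) (Vt : Submodule ℝ H) [FiniteDimensional ℝ Vt]
    {a : V →L[ℝ] V →L[ℝ] ℝ} (ha : IsCoercive a)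
    (ah : sumSpace ι Vt →ₗ[ℝ] sumSpace ι Vt →ₗ[ℝ] ℝ)
    (hah : ∀ v w : V, ah (inclV ι Vt v) (inclV ι Vt w) = a v w) (f : H) (vt : Vt) (r : V) :
    r = ellipticReconstruction ι Vt ha ah f vt ↔
      ∀ v : V, ah (inclV ι Vt r) (inclV ι Vt v)
        = ⟪(discreteOp ι Vt ah vt : H) - (Vt.orthogonalProjectionOnto f : H) + f, ι v⟫_ℝ := by
  rw [ellipticReconstruction, ContinuousLinearEquiv.eq_symm_apply]
  constructor
  · intro h v
    rw [hah, ← ha.continuousLinearEquivOfBilin_apply, h, ContinuousLinearMap.adjoint_inner_left]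
  · intro h
    refine ext_inner_right ℝ fun v => ?_
    rw [ha.continuousLinearEquivOfBilin_apply, ContinuousLinearMap.adjoint_inner_left, ← hah, h]

/-- `γ_h`, the (best) continuity constant of `a_h` on `V` with respect to the norm `p`. -/
def continuityConst (ι : V →L[ℝ] H) (Vt : Submodule ℝ H)
    (ah : sumSpace ι Vt →ₗ[ℝ] sumSpace ι Vt →ₗ[ℝ] ℝ) (p : Seminorm ℝ (sumSpace ι Vt)) : ℝ :=
  sInf {c : ℝ | 0 ≤ c ∧ ∀ v w : V,
    |ah (inclV ι Vt v) (inclV ι Vt w)| ≤ c * p (inclV ι Vt v) * p (inclV ι Vt w)}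

/-- `C_{H,V}^b`, the (best) constant in `‖v‖_H ≤ C p(v)` for `v ∈ V`. -/
def embeddingConst (ι : V →L[ℝ] H) (Vt : Submodule ℝ H) (p : Seminorm ℝ (sumSpace ι Vt)) : ℝ :=
  sInf {c : ℝ | 0 ≤ c ∧ ∀ v : V, ‖ι v‖ ≤ c * p (inclV ι Vt v)}

/-- The dual norm `sup_{0 ≠ v ∈ V} (h, v) / p(v)` of an element `h` of `H`, considered as a
functional on `V`. The term of `v = 0` is `0` and does not change the supremum. -/
def dualNorm (ι : V →L[ℝ] H) (Vt : Submodule ℝ H) (p : Seminorm ℝ (sumSpace ι Vt)) (h : H) : ℝ :=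
  ⨆ v : V, ⟪h, ι v⟫_ℝ / p (inclV ι Vt v)

end Spaces

end ParabolicEstimate

end

open ParabolicEstimate

/-! The proof is an energy argument for the conforming error `e^c`. Since the time residual equals
`∂ₜũ + A_h ũ - Π̃f`, the right-hand side of the elliptic reconstruction is `R_T - ∂ₜũ + f`.
Subtracting the reconstruction from the parabolic equation and testing with `e^c` removes `f` and
`A_h ũ`, which leaves `⟨∂ₜe^c, e^c⟩ + |||e^c|||² = a(R_ell(ũ) - ũ^c, e^c) + (∂ₜũ^d, e^c) - (R_T,
e^c)`. Here `R_ell(ũ) - ũ^c = ε + ũ^d`, so the right side is at most `X |||e^c|||` with `X = γ_h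
(|||ε||| + |||ũ^d|||) + |||∂ₜũ^d|||_{V,-1} + C_{H,V}^b ‖R_T‖` (`error_equation_le`). Young's
inequality, integration in time, and `0 ≤ ‖e^c(0)‖² + 2∫⟨∂ₜe^c, e^c⟩` bound the norm of `e^c` by
`‖e^c(0)‖ + ‖X‖`; finally `e = e^c - ũ^d`.

The analytic core is that last inequality (`neg_norm_sq_le_integral`), half of the Lions-Magenes
identity. It is obtained without mollifying: integrate `‖w(r)‖² - ‖w(r-h)‖² ≤ 2 (w(r) - w(r-h),
w(r))` over `r`, write the increment as an integral of the weak derivative, divide by `h` and let `h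
→ 0`, using continuity of translations in `L²`. Pairing only with `w(r)`, which lies in `V` for
almost every `r`, makes the duality meaningful. -/

namespace ParabolicEstimate

open Filter Topology

/-! ### Weak derivatives and primitives on `(0, T)`. -/

section WeakDerivative

variable {E : Type*} [NormedAddCommGroup E] [NormedSpace ℝ E] {T : ℝ}

theorem integrable_deriv_of_hasCompactSupport {φ : ℝ → ℝ} (hφ : ContDiff ℝ ∞ φ)
    (hc : HasCompactSupport φ) : Integrable (deriv φ) :=
  (hφ.continuous_deriv (by simp)).integrable_of_hasCompactSupport hc.deriv

theorem integrable_testFunction_smul {φ : ℝ → ℝ} (hφ : Continuous φ) (hc : HasCompactSupport φ)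
    {g : ℝ → E} {μ : Measure ℝ} (hg : Integrable g μ) : Integrable (fun t => φ t • g t) μ := by
  obtain ⟨M, hM⟩ := hφ.bounded_above_of_compact_support hc
  exact hg.bdd_smul M hφ.aestronglyMeasurable (ae_of_all _ hM)

/-- Integration by parts of a test function against a primitive of an integrable function. -/
theorem integral_deriv_smul_primitive [CompleteSpace E] {g' : ℝ → E}
    (hg' : Integrable g' (timeMeasure T)) {φ : ℝ → ℝ} (hφ : ContDiff ℝ ∞ φ)
    (hc : HasCompactSupport φ) (hs : tsupport φ ⊆ Ioo 0 T) :
    ∫ t in Ioo 0 T, deriv φ t • ∫ s in (0 : ℝ)..t, g' s = -∫ t in Ioo 0 T, φ t • g' t := by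
  have hφT : φ T = 0 := by
    by_contra h
    exact (hs (subset_tsupport _ h)).2.false
  have hint : Integrable (fun z : ℝ × ℝ => deriv φ z.1 • g' z.2)
      ((timeMeasure T).prod (timeMeasure T)) :=
    ((integrable_deriv_of_hasCompactSupport hφ hc).restrict).smul_prod hg'
  have hmeas : MeasurableSet {z : ℝ × ℝ | z.2 ≤ z.1} :=
    measurableSet_le measurable_snd measurable_fst
  -- Fubini on the triangle `s ≤ t`: for fixed `s`, the integral of `φ'` over `(s, T)` is `φ(T) -
  -- φ(s) = -φ(s)`.
  have hF : Integrable (Function.uncurry fun t s => {z : ℝ × ℝ | z.2 ≤ z.1}.indicator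
      (fun z : ℝ × ℝ => deriv φ z.1 • g' z.2) (t, s)) ((timeMeasure T).prod (timeMeasure T)) :=
    hint.indicator hmeas
  have h1 : ∀ t ∈ Ioo 0 T, deriv φ t • ∫ s in (0 : ℝ)..t, g' s
      = ∫ s in Ioo 0 T, {z : ℝ × ℝ | z.2 ≤ z.1}.indicator
          (fun z : ℝ × ℝ => deriv φ z.1 • g' z.2) (t, s) := by
    intro t ht
    have : (fun s => {z : ℝ × ℝ | z.2 ≤ z.1}.indicator
          (fun z : ℝ × ℝ => deriv φ z.1 • g' z.2) (t, s))
        = (Iic t).indicator (fun s => deriv φ t • g' s) := by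
      ext s; simp [indicator_apply]
    rw [this, integral_indicator measurableSet_Iic, Measure.restrict_restrict measurableSet_Iic,
      integral_smul, intervalIntegral.integral_of_le ht.1.le]
    congr 3
    ext s
    simp only [mem_Ioc, mem_inter_iff, mem_Iic, mem_Ioo]
    exact ⟨fun h => ⟨h.2, h.1, h.2.trans_lt ht.2⟩, fun h => ⟨h.2.1, h.1⟩⟩
  have h2 : ∀ s ∈ Ioo 0 T, ∫ t in Ioo 0 T, {z : ℝ × ℝ | z.2 ≤ z.1}.indicator
          (fun z : ℝ × ℝ => deriv φ z.1 • g' z.2) (t, s) = -(φ s • g' s) := by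
    intro s hs
    have : (fun t => {z : ℝ × ℝ | z.2 ≤ z.1}.indicator
          (fun z : ℝ × ℝ => deriv φ z.1 • g' z.2) (t, s))
        = (Ici s).indicator (fun t => deriv φ t • g' s) := by
      ext s; simp [indicator_apply]
    have hset : Ici s ∩ Ioo 0 T = Ico s T := by
      ext t
      simp only [mem_Ico, mem_inter_iff, mem_Ici, mem_Ioo]
      exact ⟨fun h => ⟨h.1, h.2.2⟩, fun h => ⟨h.1, hs.1.trans_le h.1, h.2⟩⟩
    rw [this, integral_indicator measurableSet_Ici, Measure.restrict_restrict measurableSet_Ici,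
      integral_smul_const, hset, integral_Ico_eq_integral_Ioc,
      ← intervalIntegral.integral_of_le hs.2.le, intervalIntegral.integral_deriv_eq_sub, hφT,
      zero_sub, neg_smul]
    · exact fun x _ => (hφ.differentiable (by simp)).differentiableAt
    · exact (hφ.continuous_deriv (by simp)).intervalIntegrable _ _
  rw [setIntegral_congr_fun measurableSet_Ioo h1, integral_integral_swap hF,
    setIntegral_congr_fun measurableSet_Ioo h2, integral_neg]

theorem continuousOn_primitive_timeMeasure {g' : ℝ → E} (hT : 0 < T)
    (hg' : Integrable g' (timeMeasure T)) :
    ContinuousOn (fun t => ∫ s in (0 : ℝ)..t, g' s) (Icc 0 T) := by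
  have := intervalIntegral.continuousOn_primitive_interval (a := 0) (b := T) (f := g')
    (μ := volume) (by rw [uIcc_of_le hT.le, integrableOn_Icc_iff_integrableOn_Ioo]; exact hg')
  rwa [uIcc_of_le hT.le] at this

theorem _root_.ContinuousOn.integrable_timeMeasure {E : Type*} [NormedAddCommGroup E] {T : ℝ}
    {g : ℝ → E} (hg : ContinuousOn g (Icc 0 T)) :
    Integrable g (timeMeasure T) :=
  (hg.integrableOn_Icc).mono_set Ioo_subset_Icc_self

theorem exists_testFunction_integral_eq_one (hT : 0 < T) : ∃ ρ : ℝ → ℝ, ContDiff ℝ ∞ ρ ∧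
    HasCompactSupport ρ ∧ tsupport ρ ⊆ Ioo 0 T ∧ ∫ t, ρ t = 1 := by
  let b : ContDiffBump (T / 2) := ⟨T / 8, T / 4, by positivity, by linarith⟩
  refine ⟨b.normed volume, b.contDiff_normed, b.hasCompactSupport_normed, ?_, b.integral_normed⟩
  rw [b.tsupport_normed_eq]
  intro x hx
  rw [Metric.mem_closedBall, Real.dist_eq, abs_le] at hx
  simp only [b] at hx
  constructor <;> linarith [hx.1, hx.2]

/-- A test function of integral zero is the derivative of a test function. -/
theorem exists_testFunction_deriv_eq {ψ : ℝ → ℝ} (hψ : ContDiff ℝ ∞ ψ)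
    (hc : HasCompactSupport ψ) (hs : tsupport ψ ⊆ Ioo 0 T) (h0 : ∫ t, ψ t = 0) :
    ∃ φ : ℝ → ℝ, ContDiff ℝ ∞ φ ∧ HasCompactSupport φ ∧ tsupport φ ⊆ Ioo 0 T ∧ deriv φ = ψ := by
  have hint : Integrable ψ := hψ.continuous.integrable_of_hasCompactSupport hc
  by_cases hne : (tsupport ψ).Nonempty
  swap
  · have : ψ = 0 := by
      rw [not_nonempty_iff_eq_empty, tsupport_eq_empty_iff] at hne
      exact hne
    exact ⟨0, contDiff_const, HasCompactSupport.zero, by simp [tsupport], by ext; simp [this]⟩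
  have hcomp : IsCompact (tsupport ψ) := hc
  obtain ⟨α, hα⟩ := hcomp.exists_isLeast hne
  obtain ⟨β, hβ⟩ := hcomp.exists_isGreatest hne
  let φ : ℝ → ℝ := fun t => ∫ s in (0 : ℝ)..t, ψ s
  have hd : ∀ t, HasDerivAt φ (ψ t) t := fun t =>
    intervalIntegral.integral_hasDerivAt_right (hψ.continuous.intervalIntegrable _ _)
      hψ.continuous.stronglyMeasurable.stronglyMeasurableAtFilter hψ.continuous.continuousAt
  have hderiv : deriv φ = ψ := funext fun t => (hd t).deriv
  have hz : ∀ t, t ∉ Icc α β → ψ t = 0 := fun t ht => by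
    by_contra h
    have := subset_tsupport _ h
    exact ht ⟨hα.2 this, hβ.2 this⟩
  -- To the left of `α` the primitive has not started to grow; to the right of `β` it equals the
  -- full integral of `ψ`, which is zero. As `α` and `β` lie in the open interval, so does `[α, β]`.
  have hsub : tsupport φ ⊆ Icc α β := by
    refine closure_minimal (fun t ht => ?_) isClosed_Icc
    by_contra hn
    apply ht
    have hα0 := hs hα.1
    have hβT := hs hβ.1
    rw [mem_Icc, not_and_or, not_le, not_le] at hn
    rcases hn with hn | hn
    · refine (intervalIntegral.integral_congr (g := fun _ => 0) fun s hs' => ?_).trans (by simp)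
      refine hz s fun h => ?_
      rcases mem_uIcc.1 hs' with h' | h' <;> linarith [h.1, h'.2, hα0.1]
    · have : φ t = ∫ s, ψ s := by
        have h0t : 0 ≤ t := by linarith [hβT.1]
        refine (intervalIntegral.integral_of_le h0t).trans ?_
        rw [setIntegral_eq_integral_of_forall_compl_eq_zero]
        intro s hs'
        refine hz s fun h => hs' ⟨hα0.1.trans_le h.1, h.2.trans hn.le⟩
      rw [this, h0]
  refine ⟨φ, ?_, ?_, hsub.trans fun t ht => ?_, hderiv⟩
  · rw [contDiff_infty_iff_deriv, hderiv]
    exact ⟨fun t => (hd t).differentiableAt, hψ⟩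
  · exact isCompact_Icc.of_isClosed_subset (isClosed_tsupport _) hsub
  · exact ⟨(hs hα.1).1.trans_le ht.1, ht.2.trans_lt (hs hβ.1).2⟩

/-- A function with vanishing weak derivative is almost everywhere constant. -/
theorem ae_eq_const_of_isWeakDeriv_zero [CompleteSpace E] (hT : 0 < T) {g : ℝ → E}
    (hg : Integrable g (timeMeasure T)) (h : IsWeakDeriv T g 0) :
    ∃ c : E, g =ᵐ[timeMeasure T] fun _ => c := by
  obtain ⟨ρ, hρ, hρc, hρs, hρ1⟩ := exists_testFunction_integral_eq_one hT
  refine ⟨∫ t in Ioo 0 T, ρ t • g t, ?_⟩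
  set c := ∫ t in Ioo 0 T, ρ t • g t
  have hbdd : ∀ ψ : ℝ → ℝ, ContDiff ℝ ∞ ψ → HasCompactSupport ψ →
      Integrable (fun t => ψ t • g t) (timeMeasure T) :=
    fun ψ hψ hψc => integrable_testFunction_smul hψ.continuous hψc hg
  have key := isOpen_Ioo.ae_eq_zero_of_integral_contDiff_smul_eq_zero (U := Ioo 0 T) (μ := volume)
    (f := fun t => g t - c)
    ((IntegrableOn.sub hg (integrableOn_const (by simp))).locallyIntegrableOn) ?_
  · have : ∀ᵐ t ∂timeMeasure T, g t - c = 0 :=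
      (ae_restrict_iff' measurableSet_Ioo).2 key
    filter_upwards [this] with t ht using sub_eq_zero.1 ht
  intro ψ hψ hψc hψs
  have hψint : Integrable ψ := hψ.continuous.integrable_of_hasCompactSupport hψc
  have hρint : Integrable ρ := hρ.continuous.integrable_of_hasCompactSupport hρc
  have hψ0 : ∀ t, t ∉ Ioo 0 T → ψ t = 0 := fun t ht => by
    by_contra hh
    exact ht (hψs (subset_tsupport _ hh))
  set m := ∫ t, ψ t
  -- Du Bois-Reymond: `ψ - mρ` has integral zero, so it is an admissible `φ'`. Testing with it gives
  -- `∫ ψ g = m ∫ ρ g = ∫ ψ c`.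
  obtain ⟨φ, hφ, hφc, hφs, hφd⟩ := exists_testFunction_deriv_eq (T := T)
    (ψ := fun t => ψ t - m * ρ t) (hψ.sub (contDiff_const.mul hρ))
    (hψc.sub (hρc.mul_left))
    ((tsupport_sub _ _).trans (union_subset hψs
      ((tsupport_mul_subset_right (f := fun _ => m)).trans hρs)))
    (by rw [integral_sub hψint (hρint.const_mul m), integral_const_mul, hρ1]; simp [m])
  have h1 := h φ hφ hφc hφs
  rw [hφd] at h1
  simp only [Pi.zero_apply, smul_zero, integral_zero, neg_zero, sub_smul, mul_smul] at h1
  have hρm : Integrable (fun t => m • ρ t • g t) (timeMeasure T) := (hbdd ρ hρ hρc).smul m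
  rw [integral_sub (hbdd ψ hψ hψc) hρm, integral_smul] at h1
  rw [← setIntegral_eq_integral_of_forall_compl_eq_zero (s := Ioo 0 T)
    (fun t ht => by simp [hψ0 t ht])]
  simp only [smul_sub]
  rw [integral_sub (hbdd ψ hψ hψc) (hψint.restrict.smul_const c), integral_smul_const,
    setIntegral_eq_integral_of_forall_compl_eq_zero hψ0]
  exact h1

theorem _root_.MeasureTheory.Integrable.intervalIntegrable_timeMeasure {E : Type*}
    [NormedAddCommGroup E] {T : ℝ} {g : ℝ → E} (hg : Integrable g (timeMeasure T)) {a b : ℝ}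
    (ha : a ∈ Icc 0 T) (hb : b ∈ Icc 0 T) : IntervalIntegrable g volume a b := by
  have : IntegrableOn g (Icc 0 T) := by rwa [integrableOn_Icc_iff_integrableOn_Ioo]
  exact (this.mono_set (uIcc_subset_Icc ha hb)).intervalIntegrable

/-- A function with an integrable weak derivative is a primitive of it. -/
theorem IsWeakDeriv.exists_ae_eq_primitive [CompleteSpace E] (hT : 0 < T) {g g' : ℝ → E}
    (hg : Integrable g (timeMeasure T)) (hg' : Integrable g' (timeMeasure T))
    (h : IsWeakDeriv T g g') :
    ∃ c : E, g =ᵐ[timeMeasure T] fun t => c + ∫ s in (0 : ℝ)..t, g' s := by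
  have hP : Integrable (fun t => ∫ s in (0 : ℝ)..t, g' s) (timeMeasure T) :=
    (continuousOn_primitive_timeMeasure hT hg').integrable_timeMeasure
  obtain ⟨c, hc⟩ := ae_eq_const_of_isWeakDeriv_zero hT (hg.sub hP) (fun φ hφ hφc hφs => by
    have hd : Continuous (deriv φ) := hφ.continuous_deriv (by simp)
    have e : (fun t => deriv φ t • (g - fun t => ∫ s in (0 : ℝ)..t, g' s) t)
        = fun t => deriv φ t • g t - deriv φ t • ∫ s in (0 : ℝ)..t, g' s := by
      ext t; simp [smul_sub]
    rw [e, integral_sub (integrable_testFunction_smul hd hφc.deriv hg)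
        (integrable_testFunction_smul hd hφc.deriv hP),
      h φ hφ hφc hφs, integral_deriv_smul_primitive hg' hφ hφc hφs]
    simp)
  refine ⟨c, hc.mono fun t ht => ?_⟩
  simpa [sub_eq_iff_eq_add] using ht

end WeakDerivative

/-! ### Translations in `L²` and the pairing of `V'` with `V`. -/

section Translation

/-- Translations act continuously on `L²(ℝ)`. -/
theorem tendsto_eLpNorm_translate_sub {F : Type*} [NormedAddCommGroup F] {g : ℝ → F}
    (hg : MemLp g 2 volume) :
    Tendsto (fun s => (eLpNorm (fun r => g (r - s) - g r) 2 volume).toReal) (𝓝 0) (𝓝 0) := by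
  have : Fact ((2 : ℝ≥0∞) ≠ ⊤) := ⟨by simp⟩
  have hc : Continuous fun s : ℝ => DomAddAct.mk (-s) +ᵥ hg.toLp g := by
    have : Continuous fun s : ℝ => DomAddAct.mk (-s) := by fun_prop
    exact this.vadd continuous_const
  have h := ((hc.tendsto 0).dist (tendsto_const_nhds (x := hg.toLp g)))
  simp only [DomAddAct.mk_vadd_toLp, dist_edist, Lp.edist_toLp_toLp] at h
  convert h using 2
  · congr 2
    ext r
    simp [sub_eq_add_neg, add_comm]
  · symm
    convert ENNReal.toReal_zero
    simp

variable {V : Type*} [NormedAddCommGroup V] [NormedSpace ℝ V]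

theorem memLp_one_apply {α : Type*} [MeasurableSpace α] {μ : Measure α} {x : α → StrongDual ℝ V}
    {y : α → V} (hx : MemLp x 2 μ) (hy : MemLp y 2 μ) : MemLp (fun r => x r (y r)) 1 μ :=
  MemLp.of_bilin (fun (l : StrongDual ℝ V) v => l v) 1 hx hy
    ((ContinuousLinearMap.id ℝ (StrongDual ℝ V)).aestronglyMeasurable_comp₂ hx.1 hy.1)
    (ae_of_all _ fun r => by simpa using (x r).le_opNNNorm (y r))

theorem abs_integral_apply_le {α : Type*} [MeasurableSpace α] {μ : Measure α}
    {x : α → StrongDual ℝ V} {y : α → V} (hx : MemLp x 2 μ) (hy : MemLp y 2 μ) :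
    |∫ r, x r (y r) ∂μ| ≤ (eLpNorm x 2 μ).toReal * (eLpNorm y 2 μ).toReal := by
  have h := memLp_one_apply hx hy
  rw [← Real.norm_eq_abs]
  refine (norm_integral_le_integral_norm _).trans ?_
  rw [integral_norm_eq_lintegral_enorm h.1, ← eLpNorm_one_eq_lintegral_enorm, ← ENNReal.toReal_mul]
  refine ENNReal.toReal_mono (ENNReal.mul_ne_top hx.2.ne hy.2.ne) ?_
  simpa using eLpNorm_le_eLpNorm_mul_eLpNorm'_of_norm (r := 1) hx.1 hy.1
    (fun (l : StrongDual ℝ V) v => l v) 1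
    (ae_of_all _ fun r => by simpa using (x r).le_opNorm (y r))

/-- The integrand is dominated by `‖x(r - s)‖² + ‖y(r)‖²`; both terms are integrable for the product
measure because Lebesgue measure is translation invariant and `ν` is finite. This justifies Fubini
in the energy inequality. -/
theorem integrable_translate_apply {x : ℝ → StrongDual ℝ V} {y : ℝ → V}
    (hx : MemLp x 2 volume) (hy : MemLp y 2 volume) (ν : Measure ℝ) [IsFiniteMeasure ν] :
    Integrable (fun q : ℝ × ℝ => x (q.1 - q.2) (y q.1)) (volume.prod ν) := by
  have hxm : AEStronglyMeasurable (fun q : ℝ × ℝ => x (q.1 - q.2)) (volume.prod ν) :=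
    hx.1.comp_quasiMeasurePreserving (quasiMeasurePreserving_sub_of_right_invariant volume ν)
  have hym : AEStronglyMeasurable (fun q : ℝ × ℝ => y q.1) (volume.prod ν) := hy.1.comp_fst
  have hx2 : Integrable (fun q : ℝ × ℝ => ‖x (q.1 - q.2)‖ ^ 2) (volume.prod ν) := by
    have hi : Integrable (fun r => ‖x r‖ ^ 2) := hx.integrable_norm_pow (by simp)
    refine (integrable_prod_iff' (hxm.norm.pow 2)).2 ⟨ae_of_all _ fun s => hi.comp_sub_right s, ?_⟩
    have : ∀ s, ∫ r, ‖‖x (r - s)‖ ^ 2‖ = ∫ r, ‖‖x r‖ ^ 2‖ := fun s =>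
      integral_sub_right_eq_self (fun r => ‖‖x r‖ ^ 2‖) s
    exact (integrable_const _).congr (ae_of_all _ fun s => (this s).symm)
  have hy2 : Integrable (fun q : ℝ × ℝ => ‖y q.1‖ ^ 2) (volume.prod ν) :=
    (hy.integrable_norm_pow (by simp)).comp_fst ν
  refine (hx2.add hy2).mono
    ((ContinuousLinearMap.id ℝ (StrongDual ℝ V)).aestronglyMeasurable_comp₂ hxm hym)
    (ae_of_all _ fun q => ?_)
  refine ((x (q.1 - q.2)).le_opNorm (y q.1)).trans ?_
  simp only [Pi.add_apply, Real.norm_eq_abs]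
  rw [abs_of_nonneg (by positivity)]
  nlinarith [sq_nonneg (‖x (q.1 - q.2)‖ - ‖y q.1‖), sq_nonneg (‖x (q.1 - q.2)‖ + ‖y q.1‖)]

/-- Cauchy-Schwarz for `x(· - s) - x` against `y`: the cost of removing the shift tends to zero with
`s`, uniformly in `S`. -/
theorem integral_translate_apply_le {x : ℝ → StrongDual ℝ V} {y : ℝ → V}
    (hx : MemLp x 2 volume) (hy : MemLp y 2 volume) (S : Set ℝ) (s : ℝ) :
    ∫ r in S, x (r - s) (y r) ≤ (∫ r in S, x r (y r))
      + (eLpNorm (fun r => x (r - s) - x r) 2 volume).toReal * (eLpNorm y 2 volume).toReal := by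
  have hxs : MemLp (fun r => x (r - s)) 2 volume :=
    hx.comp_measurePreserving (measurePreserving_sub_right volume s)
  have hd : MemLp (fun r => x (r - s) - x r) 2 volume := hxs.sub hx
  have hsub : (∫ r in S, x (r - s) (y r)) - ∫ r in S, x r (y r)
      = ∫ r in S, (x (r - s) - x r) (y r) := by
    rw [← integral_sub (memLp_one_iff_integrable.1 (memLp_one_apply hxs hy)).restrict
      (memLp_one_iff_integrable.1 (memLp_one_apply hx hy)).restrict]
    rfl
  have hle := (le_abs_self _).trans (abs_integral_apply_le (hd.restrict S) (hy.restrict S))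
  have h1 := ENNReal.toReal_mono hd.2.ne (eLpNorm_restrict_le (fun r => x (r - s) - x r) 2 volume S)
  have h2 := ENNReal.toReal_mono hy.2.ne (eLpNorm_restrict_le y 2 volume S)
  have h3 := mul_le_mul h1 h2 ENNReal.toReal_nonneg ENNReal.toReal_nonneg
  linarith

end Translation

/-! ### The energy inequality. -/

section Energy

variable {H V : Type*} [NormedAddCommGroup H] [InnerProductSpace ℝ H]
  [NormedAddCommGroup V] [InnerProductSpace ℝ V] {T : ℝ}

theorem _root_.MeasureTheory.MemLp.integrable_timeMeasure {E : Type*} [NormedAddCommGroup E] {T : ℝ}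
    {g : ℝ → E} (hg : MemLp g 2 (timeMeasure T)) : Integrable g (timeMeasure T) :=
  hg.integrable (by norm_num)

theorem _root_.MeasureTheory.MemLp.indicator_Ioo {E : Type*} [NormedAddCommGroup E] {T : ℝ}
    {g : ℝ → E} (hg : MemLp g 2 (timeMeasure T)) : MemLp ((Ioo 0 T).indicator g) 2 volume :=
  (memLp_indicator_iff_restrict measurableSet_Ioo).2 hg

/-- The map `h ↦ (h, ·)_H` from `H` to `V'` as a continuous linear map. -/
noncomputable def toDualVL (ι : V →L[ℝ] H) : H →L[ℝ] StrongDual ℝ V :=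
  (ContinuousLinearMap.compL ℝ V H ℝ).flip ι ∘L innerSL ℝ

theorem toDualVL_apply (ι : V →L[ℝ] H) (h : H) : toDualVL ι h = toDualV ι h := rfl

theorem toDualV_apply (ι : V →L[ℝ] H) (h : H) (v : V) : toDualV ι h v = ⟪h, ι v⟫_ℝ := rfl

/-- The continuous representative of a function with values in `V` and weak derivative in `V'`
has increments, as functionals on `V`, given by integrals of the derivative. -/
theorem toDualV_sub_eq_integral (hT : 0 < T) (ι : V →L[ℝ] H) {z : ℝ → V}
    {z' : ℝ → StrongDual ℝ V} {w : ℝ → H} (hz' : MemLp z' 2 (timeMeasure T))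
    (hd : IsWeakDeriv T (fun t => toDualV ι (ι (z t))) z') (hw : ContinuousOn w (Icc 0 T))
    (hwz : w =ᵐ[timeMeasure T] fun t => ι (z t)) {s t : ℝ} (hs : s ∈ Icc 0 T) (ht : t ∈ Icc 0 T) :
    toDualV ι (w t) - toDualV ι (w s) = ∫ r in s..t, z' r := by
  have hK : ContinuousOn (fun t => toDualV ι (w t)) (Icc 0 T) :=
    (toDualVL ι).continuous.comp_continuousOn hw
  have hKz : (fun t => toDualV ι (w t)) =ᵐ[timeMeasure T] fun t => toDualV ι (ι (z t)) :=
    hwz.mono fun t ht => by simp only [ht]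
  obtain ⟨c, hc⟩ := hd.exists_ae_eq_primitive hT (hK.integrable_timeMeasure.congr hKz)
    hz'.integrable_timeMeasure
  have hP := continuousOn_primitive_timeMeasure hT hz'.integrable_timeMeasure
  -- Both sides are continuous, so almost everywhere equality becomes equality at every point of
  -- `[0, T]`, in particular at the chosen `s` and `t`.
  have hEq := Measure.eqOn_Icc_of_ae_eq volume hT.ne (f := fun t => toDualV ι (w t))
    (g := fun t => c + ∫ s in (0 : ℝ)..t, z' s)
    (by rw [← restrict_Ioo_eq_restrict_Icc]; exact hKz.trans hc) hK (continuousOn_const.add hP)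
  have hii : ∀ t ∈ Icc 0 T, IntervalIntegrable z' volume 0 t := fun t ht =>
    hz'.integrable_timeMeasure.intervalIntegrable_timeMeasure ⟨le_rfl, hT.le⟩ ht
  have e1 := hEq hs
  have e2 := hEq ht
  simp only at e1 e2
  rw [e1, e2, add_sub_add_left_eq_sub,
    intervalIntegral.integral_interval_sub_left (hii t ht) (hii s hs)]

theorem norm_sq_sub_norm_sq_le (x y : H) : ‖x‖ ^ 2 - ‖y‖ ^ 2 ≤ 2 * ⟪x - y, x⟫_ℝ := by
  have := sq_nonneg ‖x - y‖
  rw [norm_sub_sq_real] at this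
  rw [inner_sub_left, real_inner_self_eq_norm_sq, real_inner_comm]
  linarith

/-- Energy inequality for increments of length `h`, integrated in time. -/
theorem neg_integral_norm_sq_le (hT : 0 < T) (ι : V →L[ℝ] H) {z : ℝ → V}
    {z' : ℝ → StrongDual ℝ V} {w : ℝ → H} (hz : MemLp z 2 (timeMeasure T))
    (hz' : MemLp z' 2 (timeMeasure T))
    (hd : IsWeakDeriv T (fun t => toDualV ι (ι (z t))) z') (hw : ContinuousOn w (Icc 0 T))
    (hwz : w =ᵐ[timeMeasure T] fun t => ι (z t)) {h : ℝ} (hh : h ∈ Ioo 0 T) :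
    -∫ r in (0 : ℝ)..h, ‖w r‖ ^ 2 ≤
      2 * ∫ s in Ioo 0 h, ∫ r in Ioo h T,
        (Ioo 0 T).indicator z' (r - s) ((Ioo 0 T).indicator z r) := by
  have hZ : MemLp ((Ioo 0 T).indicator z) 2 volume := hz.indicator_Ioo
  have hZ' : MemLp ((Ioo 0 T).indicator z') 2 volume := hz'.indicator_Ioo
  have hF := integrable_translate_apply hZ' hZ (volume.restrict (Ioo 0 h))
  have hF2 : Integrable (Function.uncurry fun r s : ℝ =>
      (Ioo 0 T).indicator z' (r - s) ((Ioo 0 T).indicator z r))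
      ((volume.restrict (Ioo h T)).prod (volume.restrict (Ioo 0 h))) :=
    hF.mono_measure (Measure.prod_mono Measure.restrict_le_self le_rfl)
  rw [← integral_integral_swap hF2]
  have hN : ContinuousOn (fun r => ‖w r‖ ^ 2) (Icc 0 T) := hw.norm.pow 2
  have hNi : ∀ a ∈ Icc 0 T, ∀ b ∈ Icc 0 T, IntervalIntegrable (fun r => ‖w r‖ ^ 2) volume a b :=
    fun a ha b hb => (hN.mono (uIcc_subset_Icc ha hb)).intervalIntegrable
  have hhT : h ∈ Icc 0 T := ⟨hh.1.le, hh.2.le⟩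
  have h0T : (0 : ℝ) ∈ Icc 0 T := ⟨le_rfl, hT.le⟩
  have hTT : T ∈ Icc 0 T := ⟨hT.le, le_rfl⟩
  have hThT : T - h ∈ Icc 0 T := ⟨by linarith [hh.2], by linarith [hh.1]⟩
  have hshift : IntervalIntegrable (fun r => ‖w (r - h)‖ ^ 2) volume h T := by
    have := (hNi 0 h0T (T - h) hThT).comp_sub_right h
    simpa using this
  -- The integrated increment telescopes to the integral over `(T - h, T)` minus that over `(0, h)`;
  -- the former is nonnegative and is dropped.
  have hsplit : -∫ r in (0 : ℝ)..h, ‖w r‖ ^ 2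
      ≤ ∫ r in h..T, (‖w r‖ ^ 2 - ‖w (r - h)‖ ^ 2) := by
    rw [intervalIntegral.integral_sub (hNi h hhT T hTT) hshift,
      intervalIntegral.integral_comp_sub_right (fun r => ‖w r‖ ^ 2) h, sub_self]
    have e1 := intervalIntegral.integral_add_adjacent_intervals (hNi 0 h0T h hhT) (hNi h hhT T hTT)
    have e2 := intervalIntegral.integral_add_adjacent_intervals (hNi 0 h0T (T - h) hThT)
      (hNi (T - h) hThT T hTT)
    have e3 : 0 ≤ ∫ r in (T - h)..T, ‖w r‖ ^ 2 :=
      intervalIntegral.integral_nonneg (by linarith [hh.1]) fun _ _ => by positivity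
    linarith
  refine hsplit.trans ?_
  rw [intervalIntegral.integral_of_le hh.2.le, integral_Ioc_eq_integral_Ioo,
    ← integral_const_mul]
  refine integral_mono_ae ?_ (hF2.integral_prod_left.const_mul 2) ?_
  · have := ((hNi h hhT T hTT).sub hshift)
    rwa [intervalIntegrable_iff_integrableOn_Ioo_of_le hh.2.le] at this
  have hsub : Ioo h T ⊆ Ioo 0 T := Ioo_subset_Ioo_left hh.1.le
  filter_upwards [ae_restrict_of_ae_restrict_of_subset hsub hwz,
    ae_restrict_mem measurableSet_Ioo] with r hr hrm
  refine (norm_sq_sub_norm_sq_le _ _).trans (le_of_eq ?_)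
  congr 1
  have hrT : r ∈ Icc 0 T := Ioo_subset_Icc_self (hsub hrm)
  have hrh : r - h ∈ Icc 0 T := ⟨by linarith [hrm.1], by linarith [hrm.2, hh.1]⟩
  have hinc := toDualV_sub_eq_integral hT ι hz' hd hw hwz hrh hrT
  have hii : IntervalIntegrable z' volume (r - h) r :=
    hz'.integrable_timeMeasure.intervalIntegrable_timeMeasure hrh hrT
  -- For this `r`, `w r = ι (z r)`, so the increment in `V'` may be evaluated at `z r ∈ V`.
  have happ := congrArg (fun l : StrongDual ℝ V => l (z r)) hinc
  simp only [ContinuousLinearMap.intervalIntegral_apply hii, sub_apply,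
    toDualV_apply] at happ
  rw [← inner_sub_left, ← hr] at happ
  rw [happ, indicator_of_mem (hsub hrm)]
  have hsubst := intervalIntegral.integral_comp_sub_left (a := 0) (b := h) (fun s => z' s (z r)) r
  rw [sub_zero] at hsubst
  rw [← hsubst, intervalIntegral.integral_of_le hh.1.le, integral_Ioc_eq_integral_Ioo]
  apply setIntegral_congr_fun measurableSet_Ioo
  intro s hs
  -- With `s < h < r` the shifted time stays in `(0, T)`, so the extension by zero is never seen.
  have : r - s ∈ Ioo 0 T := ⟨by linarith [hs.2, hrm.1], by linarith [hs.1, hrm.2]⟩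
  simp only [indicator_of_mem this]

/-- Energy inequality: for `z ∈ L²(0, T; V)` with `∂ₜ z = z' ∈ L²(0, T; V')` and representative
`w ∈ C([0, T]; H)`, the quantity `‖w(0)‖² + 2 ∫ ⟨z', z⟩ = ‖w(T)‖²` is nonnegative. -/
theorem neg_norm_sq_le_integral (hT : 0 < T) (ι : V →L[ℝ] H) {z : ℝ → V}
    {z' : ℝ → StrongDual ℝ V} {w : ℝ → H} (hz : MemLp z 2 (timeMeasure T))
    (hz' : MemLp z' 2 (timeMeasure T))
    (hd : IsWeakDeriv T (fun t => toDualV ι (ι (z t))) z') (hw : ContinuousOn w (Icc 0 T))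
    (hwz : w =ᵐ[timeMeasure T] fun t => ι (z t)) :
    -‖w 0‖ ^ 2 ≤ 2 * ∫ t in Ioo 0 T, z' t (z t) := by
  set Z := (Ioo 0 T).indicator z with hZdef
  set Z' := (Ioo 0 T).indicator z' with hZ'def
  have hZ : MemLp Z 2 volume := hz.indicator_Ioo
  have hZ' : MemLp Z' 2 volume := hz'.indicator_Ioo
  have hpair : Integrable (fun t => z' t (z t)) (timeMeasure T) :=
    memLp_one_iff_integrable.1 (memLp_one_apply hz' hz)
  set I := ∫ t in Ioo 0 T, z' t (z t) with hI
  have h0T : (0 : ℝ) ∈ Icc 0 T := ⟨le_rfl, hT.le⟩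
  have hIcc : Icc 0 T ∈ 𝓝[≥] (0 : ℝ) := Icc_mem_nhdsGE hT
  refine le_of_forall_pos_le_add fun δ hδ => ?_
  -- One `η` is spent on `‖w‖²` near `0`; the translation error and the missing piece of the
  -- integral over `(0, h)` cost one each, and both are doubled.
  obtain ⟨η, hη, hηδ⟩ : ∃ η > 0, 5 * η = δ := ⟨δ / 5, by positivity, by ring⟩
  -- smallness of the three error terms for small increments
  have htr : ∀ᶠ s in 𝓝 (0 : ℝ),
      (eLpNorm (fun r => Z' (r - s) - Z' r) 2 volume).toReal * (eLpNorm Z 2 volume).toReal < η := by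
    have := (tendsto_eLpNorm_translate_sub hZ').mul_const (eLpNorm Z 2 volume).toReal
    rw [zero_mul] at this
    exact this.eventually_lt_const hη
  have hwc : ∀ᶠ r in 𝓝[≥] (0 : ℝ), ‖w r‖ ^ 2 < ‖w 0‖ ^ 2 + η := by
    have : Tendsto (fun r => ‖w r‖ ^ 2) (𝓝[Icc 0 T] 0) (𝓝 (‖w 0‖ ^ 2)) := (hw.norm.pow 2) 0 h0T
    rw [nhdsWithin_Icc_eq_nhdsGE hT] at this
    exact this.eventually_lt_const (by linarith)
  have hprim : ∀ᶠ h in 𝓝[≥] (0 : ℝ), -η < ∫ s in (0 : ℝ)..h, z' s (z s) := by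
    have : Tendsto (fun t => ∫ s in (0 : ℝ)..t, z' s (z s)) (𝓝[Icc 0 T] 0)
        (𝓝 (∫ s in (0 : ℝ)..0, z' s (z s))) := continuousOn_primitive_timeMeasure hT hpair 0 h0T
    rw [nhdsWithin_Icc_eq_nhdsGE hT, intervalIntegral.integral_same] at this
    exact this.eventually_const_lt (by linarith)
  have hall := ((htr.filter_mono nhdsWithin_le_nhds).and (hwc.and hprim))
  obtain ⟨b, hb, hbs⟩ := mem_nhdsGE_iff_exists_Icc_subset.1 hall
  have hb0 : 0 < b := hb
  obtain ⟨h, hh0, hhb, hhT⟩ : ∃ h, 0 < h ∧ h ≤ b ∧ h < T :=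
    ⟨min b (T / 2), lt_min hb0 (by linarith), min_le_left _ _,
      (min_le_right _ _).trans_lt (by linarith)⟩
  have hball : ∀ s ∈ Icc 0 h, s ∈ _ := fun s hs => hbs ⟨hs.1, hs.2.trans hhb⟩
  have hmain := neg_integral_norm_sq_le hT ι hz hz' hd hw hwz ⟨hh0, hhT⟩
  have hleft : ∫ r in (0 : ℝ)..h, ‖w r‖ ^ 2 ≤ h * (‖w 0‖ ^ 2 + η) := by
    have hci : IntervalIntegrable (fun r => ‖w r‖ ^ 2) volume 0 h :=
      ((hw.norm.pow 2).mono (uIcc_subset_Icc h0T ⟨hh0.le, hhT.le⟩)).intervalIntegrable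
    have := intervalIntegral.integral_mono_on hh0.le hci
      (intervalIntegrable_const (c := ‖w 0‖ ^ 2 + η)) fun r hr => (hball r hr).2.1.le
    simpa [mul_add] using this
  have htail : ∫ r in Ioo h T, Z' r (Z r) ≤ I + η := by
    have e : ∫ r in Ioo h T, Z' r (Z r) = ∫ r in h..T, z' r (z r) := by
      rw [intervalIntegral.integral_of_le hhT.le, integral_Ioc_eq_integral_Ioo]
      apply setIntegral_congr_fun measurableSet_Ioo
      intro r hr
      have : r ∈ Ioo 0 T := ⟨hh0.trans hr.1, hr.2⟩
      simp only [hZdef, hZ'def, indicator_of_mem this]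
    have eI : I = ∫ r in (0 : ℝ)..T, z' r (z r) := by
      rw [intervalIntegral.integral_of_le hT.le, integral_Ioc_eq_integral_Ioo]
    have hi : ∀ a ∈ Icc 0 T, ∀ b ∈ Icc 0 T,
        IntervalIntegrable (fun t => z' t (z t)) volume a b := fun a ha b hb =>
      hpair.intervalIntegrable_timeMeasure ha hb
    have hhI : h ∈ Icc 0 T := ⟨hh0.le, hhT.le⟩
    have := intervalIntegral.integral_add_adjacent_intervals (hi 0 h0T h hhI)
      (hi h hhI T ⟨hT.le, le_rfl⟩)
    have h3 := (hball h ⟨hh0.le, le_rfl⟩).2.2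
    rw [e, eI]
    linarith
  have hright : ∫ s in Ioo 0 h, ∫ r in Ioo h T, Z' (r - s) (Z r) ≤ h * (I + 2 * η) := by
    have hF2 : Integrable (Function.uncurry fun r s : ℝ => Z' (r - s) (Z r))
        ((volume.restrict (Ioo h T)).prod (volume.restrict (Ioo 0 h))) :=
      (integrable_translate_apply hZ' hZ (volume.restrict (Ioo 0 h))).mono_measure
        (Measure.prod_mono Measure.restrict_le_self le_rfl)
    have := setIntegral_mono_on (μ := volume) (s := Ioo 0 h)
      (f := fun s => ∫ r in Ioo h T, Z' (r - s) (Z r)) (g := fun _ => I + 2 * η)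
      hF2.integral_prod_right (integrableOn_const (by simp)) measurableSet_Ioo fun s hs => by
        have h1 := integral_translate_apply_le hZ' hZ (Ioo h T) s
        have h2 := (hball s ⟨hs.1.le, hs.2.le⟩).1
        linarith
    simpa [hh0.le] using this
  have hfin : h * (-‖w 0‖ ^ 2) ≤ h * (2 * I + δ) := by nlinarith
  exact le_of_mul_le_mul_left hfin hh0

end Energy

/-! ### Calculus of weak derivatives. -/

section WeakDerivativeCalculus

variable {E F : Type*} [NormedAddCommGroup E] [NormedSpace ℝ E]
  [NormedAddCommGroup F] [NormedSpace ℝ F] {T : ℝ}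

theorem IsWeakDeriv.sub {g g' k k' : ℝ → E} (hg : IsWeakDeriv T g g') (hk : IsWeakDeriv T k k')
    (ig : Integrable g (timeMeasure T)) (ig' : Integrable g' (timeMeasure T))
    (ik : Integrable k (timeMeasure T)) (ik' : Integrable k' (timeMeasure T)) :
    IsWeakDeriv T (fun t => g t - k t) (fun t => g' t - k' t) := by
  intro φ hφ hc hs
  have hd : Continuous (deriv φ) := hφ.continuous_deriv (by simp)
  simp only [smul_sub]
  rw [integral_sub (integrable_testFunction_smul hd hc.deriv ig)
      (integrable_testFunction_smul hd hc.deriv ik),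
    integral_sub (integrable_testFunction_smul hφ.continuous hc ig')
      (integrable_testFunction_smul hφ.continuous hc ik'), hg φ hφ hc hs, hk φ hφ hc hs]
  abel

theorem IsWeakDeriv.clm_comp [CompleteSpace E] [CompleteSpace F] (B : E →L[ℝ] F) {g g' : ℝ → E}
    (hg : IsWeakDeriv T g g')
    (ig : Integrable g (timeMeasure T)) (ig' : Integrable g' (timeMeasure T)) :
    IsWeakDeriv T (fun t => B (g t)) (fun t => B (g' t)) := by
  intro φ hφ hc hs
  have hd : Continuous (deriv φ) := hφ.continuous_deriv (by simp)
  simp only [← map_smul]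
  rw [B.integral_comp_comm (integrable_testFunction_smul hd hc.deriv ig),
    B.integral_comp_comm (integrable_testFunction_smul hφ.continuous hc ig'), hg φ hφ hc hs,
    map_neg]

theorem IsWeakDeriv.congr_left {g k g' : ℝ → E} (hg : IsWeakDeriv T g g')
    (h : g =ᵐ[timeMeasure T] k) : IsWeakDeriv T k g' := by
  intro φ hφ hc hs
  rw [← hg φ hφ hc hs]
  exact integral_congr_ae (h.mono fun t ht => by simp only [ht])

theorem IsH1.sub {g g' k k' : ℝ → E} (hg : IsH1 T g g') (hk : IsH1 T k k') :
    IsH1 T (fun t => g t - k t) (fun t => g' t - k' t) where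
  memLp := hg.memLp.sub hk.memLp
  memLp_deriv := hg.memLp_deriv.sub hk.memLp_deriv
  isWeakDeriv := hg.isWeakDeriv.sub hk.isWeakDeriv hg.memLp.integrable_timeMeasure
    hg.memLp_deriv.integrable_timeMeasure hk.memLp.integrable_timeMeasure
    hk.memLp_deriv.integrable_timeMeasure

theorem IsH1.exists_continuousOn [CompleteSpace E] (hT : 0 < T) {g g' : ℝ → E}
    (hg : IsH1 T g g') : ∃ w : ℝ → E, ContinuousOn w (Icc 0 T) ∧ w =ᵐ[timeMeasure T] g := by
  obtain ⟨c, hc⟩ := hg.isWeakDeriv.exists_ae_eq_primitive hT hg.memLp.integrable_timeMeasure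
    hg.memLp_deriv.integrable_timeMeasure
  exact ⟨_, continuousOn_const.add
    (continuousOn_primitive_timeMeasure hT hg.memLp_deriv.integrable_timeMeasure), hc.symm⟩

end WeakDerivativeCalculus

/-! ### Square integrability of seminorms. -/

section Seminorms

theorem lipschitzWith_of_seminorm_le {E : Type*} [NormedAddCommGroup E] [NormedSpace ℝ E]
    (s : Seminorm ℝ E) {K : ℝ} (hs : ∀ x, s x ≤ K * ‖x‖) : LipschitzWith K.toNNReal s := by
  refine LipschitzWith.of_le_add_mul' _ fun x y => ?_
  have h1 := map_add_le_add s y (x - y)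
  rw [add_sub_cancel] at h1
  rw [dist_eq_norm]
  linarith [hs (x - y)]

theorem memLp_seminorm {α E : Type*} [MeasurableSpace α] {μ : Measure α} [NormedAddCommGroup E]
    [NormedSpace ℝ E] (s : Seminorm ℝ E) {K : ℝ} (hs : ∀ x, s x ≤ K * ‖x‖) {g : α → E}
    (hg : MemLp g 2 μ) : MemLp (fun t => s (g t)) 2 μ :=
  (lipschitzWith_of_seminorm_le s hs).comp_memLp (map_zero s) hg

/-- A seminorm is convex, and a convex function on a finite-dimensional space is continuous. -/
theorem exists_seminorm_le_of_finiteDimensional {E : Type*} [NormedAddCommGroup E]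
    [NormedSpace ℝ E] [FiniteDimensional ℝ E] (s : Seminorm ℝ E) :
    ∃ K : ℝ, ∀ x, s x ≤ K * ‖x‖ := by
  have hc : Continuous s :=
    continuousOn_univ.1 (s.convexOn.continuousOn isOpen_univ)
  obtain ⟨K, -, hK⟩ := s.bound_of_continuous_normedSpace hc
  exact ⟨K, hK⟩

end Seminorms

/-! ### `L²` norms as square roots of integrals. -/

section SquareIntegral

variable {α : Type*} [MeasurableSpace α] {μ : Measure α}

theorem eLpNorm_two_eq_sqrt {g : α → ℝ} (hg : MemLp g 2 μ) :
    eLpNorm g 2 μ = ENNReal.ofReal (Real.sqrt (∫ t, g t ^ 2 ∂μ)) := by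
  rw [hg.eLpNorm_eq_integral_rpow_norm (by simp) (by simp), Real.sqrt_eq_rpow]
  simp

/-- This is `√(K² + c²) ≤ K + c`; it lets the initial error enter with constant one. -/
theorem eLpNorm_two_le_add {g k : α → ℝ} (hg : MemLp g 2 μ) (hk : MemLp k 2 μ) {c : ℝ}
    (hc : 0 ≤ c) (h : ∫ t, g t ^ 2 ∂μ ≤ (∫ t, k t ^ 2 ∂μ) + c ^ 2) :
    eLpNorm g 2 μ ≤ ENNReal.ofReal c + eLpNorm k 2 μ := by
  rw [eLpNorm_two_eq_sqrt hg, eLpNorm_two_eq_sqrt hk, ← ENNReal.ofReal_add hc (Real.sqrt_nonneg _)]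
  refine ENNReal.ofReal_le_ofReal (Real.sqrt_le_iff.2 ⟨by positivity, h.trans ?_⟩)
  have h0 : 0 ≤ ∫ t, k t ^ 2 ∂μ := integral_nonneg fun t => sq_nonneg _
  nlinarith [Real.sq_sqrt h0, Real.sqrt_nonneg (∫ t, k t ^ 2 ∂μ)]

theorem eLpNorm_const_mul_of_nonneg {c : ℝ} (hc : 0 ≤ c) (g : α → ℝ) :
    eLpNorm (fun t => c * g t) 2 μ = ENNReal.ofReal c * eLpNorm g 2 μ := by
  have := eLpNorm_const_smul c g 2 μ
  rwa [Real.enorm_of_nonneg hc] at this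

end SquareIntegral

/-! ### The energy norm, its constants and the dual norm. -/

section Spaces

variable {H V : Type*} [NormedAddCommGroup H] [InnerProductSpace ℝ H]
  [NormedAddCommGroup V] [InnerProductSpace ℝ V]
  {ι : V →L[ℝ] H} {a : V →L[ℝ] V →L[ℝ] ℝ} {Vt : Submodule ℝ H}
  {ah : sumSpace ι Vt →ₗ[ℝ] sumSpace ι Vt →ₗ[ℝ] ℝ} {p : Seminorm ℝ (sumSpace ι Vt)}

theorem coe_inclV (v : V) : (inclV ι Vt v : H) = ι v := rfl

theorem coe_inclVt (w : Vt) : (inclVt ι Vt w : H) = w := rfl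

section EnergyNorm

variable (a ah p) in
/-- The form `ah` on `V + Ṽ` extends the coercive form `a` on `V`, and the seminorm `p` is the
energy norm of `a` on `V`. -/
structure IsEnergyNorm : Prop where
  coercive : IsCoercive a
  form_eq : ∀ v w : V, ah (inclV ι Vt v) (inclV ι Vt w) = a v w
  norm_eq : ∀ v : V, p (inclV ι Vt v) = Real.sqrt (ah (inclV ι Vt v) (inclV ι Vt v))

theorem energyNorm_sq (hE : IsEnergyNorm a ah p) (v : V) : p (inclV ι Vt v) ^ 2 = a v v := by
  obtain ⟨c, hc, hcv⟩ := hE.coercive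
  rw [hE.norm_eq, hE.form_eq, Real.sq_sqrt]
  exact le_trans (by positivity) (hcv v)

theorem exists_norm_le_energyNorm (hE : IsEnergyNorm a ah p) :
    ∃ k : ℝ, 0 ≤ k ∧ ∀ v : V, ‖v‖ ≤ k * p (inclV ι Vt v) := by
  obtain ⟨c, hc, hcv⟩ := hE.coercive
  refine ⟨(Real.sqrt c)⁻¹, by positivity, fun v => ?_⟩
  rw [le_inv_mul_iff₀ (by positivity), hE.norm_eq, hE.form_eq]
  refine Real.le_sqrt_of_sq_le ?_
  rw [mul_pow, Real.sq_sqrt hc.le]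
  linarith [hcv v]

theorem energyNorm_le (hE : IsEnergyNorm a ah p) (v : V) :
    p (inclV ι Vt v) ≤ Real.sqrt ‖a‖ * ‖v‖ := by
  rw [hE.norm_eq, hE.form_eq]
  refine Real.sqrt_le_iff.2 ⟨by positivity, ?_⟩
  rw [mul_pow, Real.sq_sqrt (norm_nonneg a)]
  have := (le_abs_self _).trans (a.le_opNorm₂ v v)
  linarith

/-- The admissible constants form a closed set bounded below, and it is nonempty because coercivity
bounds `‖v‖` by the energy norm; hence the infimum is attained. -/
theorem continuityConst_mem (hE : IsEnergyNorm a ah p) :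
    0 ≤ continuityConst ι Vt ah p ∧ ∀ v w : V,
    |a v w| ≤ continuityConst ι Vt ah p * p (inclV ι Vt v) * p (inclV ι Vt w) := by
  obtain ⟨k, hk, hkv⟩ := exists_norm_le_energyNorm hE
  have hclosed : IsClosed {c : ℝ | 0 ≤ c ∧ ∀ v w : V,
      |ah (inclV ι Vt v) (inclV ι Vt w)| ≤ c * p (inclV ι Vt v) * p (inclV ι Vt w)} := by
    simp only [Set.ofPred_and, Set.ofPred_forall]
    exact isClosed_Ici.inter (isClosed_iInter fun v => isClosed_iInter fun w =>
      isClosed_le continuous_const (by fun_prop))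
  have hmem := hclosed.csInf_mem ⟨‖a‖ * k ^ 2, by positivity, fun v w => ?_⟩ ⟨0, fun c hc => hc.1⟩
  · exact ⟨hmem.1, fun v w => by rw [← hE.form_eq]; exact hmem.2 v w⟩
  · rw [hE.form_eq]
    have h1 : |a v w| ≤ ‖a‖ * ‖v‖ * ‖w‖ := a.le_opNorm₂ v w
    have h2 : ‖v‖ * ‖w‖ ≤ (k * p (inclV ι Vt v)) * (k * p (inclV ι Vt w)) :=
      mul_le_mul (hkv v) (hkv w) (norm_nonneg _) ((norm_nonneg v).trans (hkv v))
    nlinarith [mul_le_mul_of_nonneg_left h2 (norm_nonneg a)]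

theorem embeddingConst_mem (hE : IsEnergyNorm a ah p) : 0 ≤ embeddingConst ι Vt p ∧ ∀ v : V,
    ‖ι v‖ ≤ embeddingConst ι Vt p * p (inclV ι Vt v) := by
  obtain ⟨k, hk, hkv⟩ := exists_norm_le_energyNorm hE
  have hclosed : IsClosed {c : ℝ | 0 ≤ c ∧ ∀ v : V, ‖ι v‖ ≤ c * p (inclV ι Vt v)} := by
    simp only [Set.ofPred_and, Set.ofPred_forall]
    exact isClosed_Ici.inter (isClosed_iInter fun v =>
      isClosed_le continuous_const (by fun_prop))
  refine hclosed.csInf_mem ⟨‖ι‖ * k, by positivity, fun v => ?_⟩ ⟨0, fun c hc => hc.1⟩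
  rw [mul_assoc]
  exact (ι.le_opNorm v).trans (mul_le_mul_of_nonneg_left (hkv v) (norm_nonneg _))

theorem inner_div_energyNorm_le (hE : IsEnergyNorm a ah p) (h : H) (v : V) :
    ⟪h, ι v⟫_ℝ / p (inclV ι Vt v) ≤ embeddingConst ι Vt p * ‖h‖ := by
  obtain ⟨hb, hbv⟩ := embeddingConst_mem hE
  refine div_le_of_le_mul₀ (apply_nonneg p _) (by positivity) ?_
  have := (real_inner_le_norm h (ι v)).trans (mul_le_mul_of_nonneg_left (hbv v) (norm_nonneg h))
  linarith

theorem bddAbove_dualNorm (hE : IsEnergyNorm a ah p) (h : H) :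
    BddAbove (range fun v : V => ⟪h, ι v⟫_ℝ / p (inclV ι Vt v)) :=
  ⟨embeddingConst ι Vt p * ‖h‖, by
    rintro _ ⟨v, rfl⟩
    exact inner_div_energyNorm_le hE h v⟩

theorem inner_le_dualNorm_mul (hE : IsEnergyNorm a ah p) (h : H) (v : V) :
    ⟪h, ι v⟫_ℝ ≤ dualNorm ι Vt p h * p (inclV ι Vt v) := by
  have hle : ⟪h, ι v⟫_ℝ / p (inclV ι Vt v) ≤ dualNorm ι Vt p h :=
    le_ciSup (bddAbove_dualNorm hE h) v
  rcases (apply_nonneg p (inclV ι Vt v)).eq_or_lt with h0 | h0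
  -- If `p` vanishes at `v`, the quotient is `0` by convention and carries no information, but then
  -- `ι v = 0`.
  · have h1 := (embeddingConst_mem hE).2 v
    rw [← h0, mul_zero, norm_le_zero_iff] at h1
    rw [h1, ← h0]
    simp
  · exact (div_le_iff₀ h0).1 hle

theorem lipschitzWith_dualNorm (hE : IsEnergyNorm a ah p) :
    LipschitzWith (embeddingConst ι Vt p).toNNReal (dualNorm ι Vt p) := by
  refine LipschitzWith.of_le_add_mul' _ fun x y => ?_
  refine ciSup_le fun v => ?_
  have h1 : ⟪y, ι v⟫_ℝ / p (inclV ι Vt v) ≤ dualNorm ι Vt p y :=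
    le_ciSup (bddAbove_dualNorm hE y) v
  have h2 := inner_div_energyNorm_le hE (x - y) v
  rw [inner_sub_left, sub_div] at h2
  rw [dist_eq_norm]
  linarith

theorem memLp_dualNorm (hE : IsEnergyNorm a ah p) {α : Type*} [MeasurableSpace α]
    {μ : Measure α} {g : α → H}
    (hg : MemLp g 2 μ) : MemLp (fun t => dualNorm ι Vt p (g t)) 2 μ :=
  (lipschitzWith_dualNorm hE).comp_memLp (by simp [dualNorm]) hg

theorem memLp_energyNorm (hE : IsEnergyNorm a ah p) {α : Type*} [MeasurableSpace α]
    {μ : Measure α} {v : α → V}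
    (hv : MemLp v 2 μ) : MemLp (fun t => p (inclV ι Vt (v t))) 2 μ :=
  memLp_seminorm (p.comp (inclV ι Vt)) (energyNorm_le hE) hv

/-- `p` need not be continuous for the norm that `V + Ṽ` inherits from `H`. Pulled back to `V × Ṽ`
along `(v, w) ↦ v - w` it is bounded, which yields measurability and integrability. -/
theorem memLp_seminorm_inclV_sub_inclVt (hE : IsEnergyNorm a ah p) [FiniteDimensional ℝ Vt]
    {α : Type*} [MeasurableSpace α] {μ : Measure α} {v : α → V} {w : α → Vt}
    (hv : MemLp v 2 μ) (hw : MemLp w 2 μ) :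
    MemLp (fun t => p (inclV ι Vt (v t) - inclVt ι Vt (w t))) 2 μ := by
  obtain ⟨K, hK⟩ := exists_seminorm_le_of_finiteDimensional (p.comp (inclVt ι Vt))
  have hpair : MemLp (fun t => (v t, w t)) 2 μ := by
    have := ((ContinuousLinearMap.inl ℝ V Vt).comp_memLp' hv).add
      ((ContinuousLinearMap.inr ℝ V Vt).comp_memLp' hw)
    refine this.ae_eq (ae_of_all _ fun t => ?_)
    simp
  have hbound : ∀ x : V × Vt,
      (p.comp ((inclV ι Vt).coprod (-inclVt ι Vt))) x ≤ (Real.sqrt ‖a‖ + |K|) * ‖x‖ := by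
    intro x
    rw [Seminorm.comp_apply, LinearMap.coprod_apply]
    refine (map_add_le_add p _ _).trans ?_
    rw [LinearMap.neg_apply, map_neg_eq_map, add_mul]
    refine add_le_add ((energyNorm_le hE x.1).trans
      (mul_le_mul_of_nonneg_left (norm_fst_le x) (by positivity))) ((hK x.2).trans ?_)
    exact mul_le_mul (le_abs_self K) (norm_snd_le x) (norm_nonneg _) (abs_nonneg _)
  have := memLp_seminorm _ hbound hpair
  simpa [sub_eq_add_neg] using this

end EnergyNorm


theorem memLp_seminorm_inclVt [FiniteDimensional ℝ Vt] {α : Type*} [MeasurableSpace α]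
    {μ : Measure α} {w : α → Vt}
    (hw : MemLp w 2 μ) : MemLp (fun t => p (inclVt ι Vt (w t))) 2 μ := by
  obtain ⟨K, hK⟩ := exists_seminorm_le_of_finiteDimensional (p.comp (inclVt ι Vt))
  exact memLp_seminorm _ hK hw

/-- A function of time that is pointwise the conforming part of a function with values in `Ṽ` is
square integrable with values in `V`. -/
theorem memLp_of_ae_eq_coe [FiniteDimensional ℝ Vt] (hι : Function.Injective ι) {α : Type*}
    [MeasurableSpace α] {μ : Measure α} {c : α → V} {y : α → Vt} (hy : MemLp y 2 μ)
    (h : ∀ᵐ t ∂μ, (y t : H) = ι (c t)) : MemLp c 2 μ := by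
  -- This left inverse of `ι` is merely linear on `H`; its restriction to `Ṽ` is continuous by
  -- finite dimension.
  obtain ⟨g, hg⟩ := (ι : V →ₗ[ℝ] H).exists_leftInverse_of_injective
    (LinearMap.ker_eq_bot.2 hι)
  refine ((LinearMap.toContinuousLinearMap (g ∘ₗ Vt.subtype)).comp_memLp' hy).ae_eq
    (h.mono fun t ht => ?_)
  have : g (ι (c t)) = c t := LinearMap.congr_fun hg (c t)
  simp [ht, this]

/-! ### The discrete operator, time residual and elliptic reconstruction. -/

section Reconstruction

variable [CompleteSpace H] [FiniteDimensional ℝ Vt]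

theorem inner_discreteOp (vt w : Vt) : ⟪(discreteOp ι Vt ah vt : H), (w : H)⟫_ℝ
    = ah (inclVt ι Vt vt) (inclVt ι Vt w) := by
  rw [discreteOp, inner_rieszRep]
  rfl

/-- Elements of `Ṽ` see `f` only through its projection. In this form the residual matches the
right-hand side of the reconstruction. -/
theorem timeResidual_eq [CompleteSpace V] (f : H) (x y : Vt) : timeResidual ι Vt ah f x y
    = y + discreteOp ι Vt ah x - Vt.orthogonalProjectionOnto f := by
  refine ext_inner_right ℝ fun w => ?_
  rw [Submodule.coe_inner, inner_timeResidual, Submodule.coe_inner]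
  push_cast
  rw [inner_sub_left, inner_add_left, inner_discreteOp, ← Submodule.coe_inner,
    ← Submodule.coe_inner, ← Submodule.inner_orthogonalProjectionOnto_eq_of_mem_right,
    Submodule.coe_inner, Submodule.coe_inner]

variable (ι Vt ah) in
/-- The discrete operator `A_h` as a continuous linear map. -/
noncomputable def discreteOpL : Vt →L[ℝ] Vt :=
  LinearMap.toContinuousLinearMap
    { toFun := discreteOp ι Vt ah
      map_add' := fun x y => ext_inner_right ℝ fun w => by
        simp only [Submodule.coe_inner, inner_add_left, inner_discreteOp,
          map_add, LinearMap.add_apply]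
      map_smul' := fun c x => ext_inner_right ℝ fun w => by
        simp only [Submodule.coe_inner, inner_smul_left, inner_discreteOp,
          map_smul, LinearMap.smul_apply, RingHom.id_apply]
        simp }

theorem memLp_discreteOp {α : Type*} [MeasurableSpace α] {μ : Measure α} {x : α → Vt}
    (hx : MemLp x 2 μ) : MemLp (fun t => discreteOp ι Vt ah (x t)) 2 μ :=
  (discreteOpL ι Vt ah).comp_memLp' hx

theorem memLp_timeResidual [CompleteSpace V] {α : Type*} [MeasurableSpace α]
    {μ : Measure α} [IsFiniteMeasure μ]
    (f : H) {x y : α → Vt} (hx : MemLp x 2 μ) (hy : MemLp y 2 μ) :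
    MemLp (fun t => timeResidual ι Vt ah f (x t) (y t)) 2 μ := by
  simp only [timeResidual_eq]
  exact (hy.add (memLp_discreteOp hx)).sub (memLp_const _)

theorem memLp_ellipticReconstruction [CompleteSpace V] {α : Type*} [MeasurableSpace α]
    {μ : Measure α} [IsFiniteMeasure μ] (ha : IsCoercive a) (f : H) {x : α → Vt}
    (hx : MemLp x 2 μ) : MemLp (fun t => ellipticReconstruction ι Vt ha ah f (x t)) 2 μ := by
  have h1 : MemLp (fun t => (discreteOp ι Vt ah (x t) : H)
      - (Vt.orthogonalProjectionOnto f : H) + f) 2 μ :=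
    ((Vt.subtypeL.comp_memLp' (memLp_discreteOp hx)).sub (memLp_const _)).add (memLp_const _)
  exact ((ha.continuousLinearEquivOfBilin.symm : V →L[ℝ] V) ∘L
    ContinuousLinearMap.adjoint ι).comp_memLp' h1

end Reconstruction

end Spaces

/-! ### The error equation and the final estimate. -/

section Estimate

variable {H V : Type*} [NormedAddCommGroup H] [InnerProductSpace ℝ H] [CompleteSpace H]
  [NormedAddCommGroup V] [InnerProductSpace ℝ V] [CompleteSpace V]
  {ι : V →L[ℝ] H} {a : V →L[ℝ] V →L[ℝ] ℝ} {Vt : Submodule ℝ H} [FiniteDimensional ℝ Vt]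
  {ah : sumSpace ι Vt →ₗ[ℝ] sumSpace ι Vt →ₗ[ℝ] ℝ} {p : Seminorm ℝ (sumSpace ι Vt)}

/-- The error equation at one time, tested with the conforming part `x - c` of the error. -/
theorem error_equation_le (hE : IsEnergyNorm a ah p) {f : H} {l : StrongDual ℝ V} {x c : V}
    (hx : ∀ v : V, l v + a x v = ⟪f, ι v⟫_ℝ) {y y' d d' : Vt} (hy : (y : H) = ι c + (d : H)) :
    (l - toDualV ι ((y' - d' : Vt) : H)) (x - c) + p (inclV ι Vt (x - c)) ^ 2 ≤
      (continuityConst ι Vt ah p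
          * (p (inclV ι Vt (ellipticReconstruction ι Vt hE.coercive ah f y) - inclVt ι Vt y)
            + p (inclVt ι Vt d))
        + dualNorm ι Vt p d'
        + embeddingConst ι Vt p * ‖timeResidual ι Vt ah f y y'‖) * p (inclV ι Vt (x - c)) := by
  set r := ellipticReconstruction ι Vt hE.coercive ah f y with hr
  set z := x - c with hz
  have hrec := (ellipticReconstruction_iff ι Vt hE.coercive ah hE.form_eq f y r).1 hr z
  rw [hE.form_eq] at hrec
  obtain ⟨hγ, hγv⟩ := continuityConst_mem hE
  obtain ⟨-, hbv⟩ := embeddingConst_mem hE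
  -- Continuity of the form is available only on `V`, so it is applied to `r - c ∈ V` first; the
  -- nonconforming splitting is made only inside the norm.
  have hincl : inclV ι Vt (r - c) = (inclV ι Vt r - inclVt ι Vt y) + inclVt ι Vt d := by
    apply Subtype.ext
    push_cast
    rw [coe_inclV, coe_inclV, coe_inclVt, coe_inclVt, hy, map_sub]
    abel
  have h1 : a (r - c) z ≤ continuityConst ι Vt ah p
      * (p (inclV ι Vt r - inclVt ι Vt y) + p (inclVt ι Vt d)) * p (inclV ι Vt z) := by
    refine (le_abs_self _).trans ((hγv _ _).trans ?_)
    rw [hincl]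
    gcongr
    exact map_add_le_add p _ _
  have h2 := inner_le_dualNorm_mul hE (d' : H) z
  have h3 : -⟪(timeResidual ι Vt ah f y y' : H), ι z⟫_ℝ
      ≤ embeddingConst ι Vt p * ‖timeResidual ι Vt ah f y y'‖ * p (inclV ι Vt z) := by
    have := (neg_le_abs _).trans (abs_real_inner_le_norm (timeResidual ι Vt ah f y y' : H) (ι z))
    refine this.trans ((mul_le_mul_of_nonneg_left (hbv z) (norm_nonneg _)).trans (le_of_eq ?_))
    rw [Submodule.coe_norm]
    ring
  have hsq := energyNorm_sq hE z
  have heq : (l - toDualV ι ((y' - d' : Vt) : H)) z + a z z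
      = a (r - c) z + ⟪(d' : H), ι z⟫_ℝ - ⟪(timeResidual ι Vt ah f y y' : H), ι z⟫_ℝ := by
    have hxz := hx z
    have hxs : a x z = a z z + a c z := by
      conv_lhs => rw [← sub_add_cancel x c]
      rw [map_add]
      rfl
    have hrs : a (r - c) z = a r z - a c z := by rw [map_sub a r c]; rfl
    rw [sub_apply, toDualV_apply, timeResidual_eq, hrs, hrec]
    push_cast
    simp only [inner_sub_left, inner_add_left]
    linarith
  rw [hsq, heq]
  linarith

end Estimate

end ParabolicEstimate

theorem mainTheorem5 {H V : Type*}
    [NormedAddCommGroup H] [InnerProductSpace ℝ H] [CompleteSpace H]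
    [NormedAddCommGroup V] [InnerProductSpace ℝ V] [CompleteSpace V]
    -- the embedding of `V` into `H`, the form `a` on `V`, and the data
    (ι : V →L[ℝ] H) (hι : Function.Injective ι)
    (a : V →L[ℝ] V →L[ℝ] ℝ) (ha : IsCoercive a)
    (f : H) (u₀ : V) (T : ℝ) (hT : 0 < T)
    -- the approximation space, the discrete form and the norm on `V + Ṽ`
    (Vt : Submodule ℝ H) [FiniteDimensional ℝ Vt]
    (ah : sumSpace ι Vt →ₗ[ℝ] sumSpace ι Vt →ₗ[ℝ] ℝ)
    (hah : ∀ v w : V, ah (inclV ι Vt v) (inclV ι Vt w) = a v w)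
    (p : Seminorm ℝ (sumSpace ι Vt)) (hp : ∀ x, p x = 0 → x = 0)
    (hpa : ∀ v : V, p (inclV ι Vt v) = Real.sqrt (ah (inclV ι Vt v) (inclV ι Vt v)))
    -- the solution `u`, the arbitrary approximation `ũ`, and a decomposition `ũ = ũᶜ + ũᵈ`
    (u : ℝ → V) (hu : IsParabolicSolution ι a f u₀ T u)
    (ut ut' : ℝ → Vt) (hut : IsH1 T ut ut')
    (uc : ℝ → V) (ud ud' : ℝ → Vt) (hud : IsH1 T ud ud')
    (hdec : ∀ᵐ t ∂timeMeasure T, (ut t : H) = ι (uc t) + (ud t : H)) :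
    let e : ℝ → sumSpace ι Vt := fun t => inclV ι Vt (u t) - inclVt ι Vt (ut t)
    let ec : ℝ → V := fun t => u t - uc t
    let ε : ℝ → sumSpace ι Vt := fun t =>
      inclV ι Vt (ellipticReconstruction ι Vt ha ah f (ut t)) - inclVt ι Vt (ut t)
    let R : ℝ → Vt := fun t => timeResidual ι Vt ah f (ut t) (ut' t)
    let γ : ℝ := continuityConst ι Vt ah p
    let C : ℝ := Real.sqrt (3 * γ ^ 2 + 2)
    -- all the norms in the estimate are finite
    MemLp (fun t => p (e t)) 2 (timeMeasure T) ∧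
    MemLp (fun t => dualNorm ι Vt p (ud' t)) 2 (timeMeasure T) ∧
    MemLp (fun t => p (ε t)) 2 (timeMeasure T) ∧
    MemLp (fun t => p (inclVt ι Vt (ud t))) 2 (timeMeasure T) ∧
    MemLp (fun t => ‖R t‖) 2 (timeMeasure T) ∧
    -- `ec₀` is `eᶜ(0)`
    ∃ ec₀ : H, HasInitialValue T (fun t => ι (ec t)) ec₀ ∧
      l2Norm T (fun t => p (e t)) ≤
        ENNReal.ofReal ‖ec₀‖
        + 2 * l2Norm T (fun t => dualNorm ι Vt p (ud' t))
        + ENNReal.ofReal (C + 1) * l2Norm T (fun t => p (ε t))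
        + ENNReal.ofReal C * l2Norm T (fun t => p (inclVt ι Vt (ud t)))
        + ENNReal.ofReal (2 * embeddingConst ι Vt p) * l2Norm T (fun t => ‖R t‖) := by
  intro e ec ε R γ C
  have hE : IsEnergyNorm a ah p := ⟨ha, hah, hpa⟩
  obtain ⟨hγ0, -⟩ := continuityConst_mem hE
  obtain ⟨hb0, -⟩ := embeddingConst_mem hE
  obtain ⟨u', hu', hud', hueq⟩ := hu.equation
  obtain ⟨wu, hwu, hwuu, -⟩ := hu.initial
  have hdiff : IsH1 T (fun t => ut t - ud t) (fun t => ut' t - ud' t) := hut.sub hud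
  obtain ⟨wd, hwd, hwdd⟩ := hdiff.exists_continuousOn hT
  have hdecι : ∀ᵐ t ∂timeMeasure T, ((ut t - ud t : Vt) : H) = ι (uc t) :=
    hdec.mono fun t ht => by push_cast; rw [ht, add_sub_cancel_right]
  have huc : MemLp uc 2 (timeMeasure T) := memLp_of_ae_eq_coe hι hdiff.memLp hdecι
  have hec : MemLp ec 2 (timeMeasure T) := hu.memLp.sub huc
  -- the norms in the estimate
  have me : MemLp (fun t => p (e t)) 2 (timeMeasure T) :=
    memLp_seminorm_inclV_sub_inclVt hE hu.memLp hut.memLp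
  have mdual : MemLp (fun t => dualNorm ι Vt p (ud' t)) 2 (timeMeasure T) :=
    memLp_dualNorm hE (Vt.subtypeL.comp_memLp' hud.memLp_deriv)
  have mε : MemLp (fun t => p (ε t)) 2 (timeMeasure T) :=
    memLp_seminorm_inclV_sub_inclVt hE (memLp_ellipticReconstruction ha f hut.memLp) hut.memLp
  have md : MemLp (fun t => p (inclVt ι Vt (ud t))) 2 (timeMeasure T) :=
    memLp_seminorm_inclVt hud.memLp
  have mR : MemLp (fun t => ‖R t‖) 2 (timeMeasure T) :=
    (memLp_timeResidual f hut.memLp hut.memLp_deriv).norm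
  have mz : MemLp (fun t => p (inclV ι Vt (ec t))) 2 (timeMeasure T) := memLp_energyNorm hE hec
  refine ⟨me, mdual, mε, md, mR, ?_⟩
  -- the continuous representative of `eᶜ`
  let w : ℝ → H := fun t => wu t - (wd t : H)
  have hw : ContinuousOn w (Icc 0 T) := hwu.sub (continuous_subtype_val.comp_continuousOn hwd)
  have hwec : w =ᵐ[timeMeasure T] fun t => ι (ec t) := by
    filter_upwards [hwuu, hwdd, hdecι] with t h1 h2 h3
    simp only [w, ec]
    rw [h1, h2, h3, map_sub]
  refine ⟨w 0, ⟨w, hw, hwec, rfl⟩, ?_⟩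
  -- the weak derivative of `eᶜ`
  let z' : ℝ → StrongDual ℝ V := fun t => u' t - toDualV ι ((ut' t - ud' t : Vt) : H)
  have mι : MemLp (fun t => toDualV ι (ι (u t))) 2 (timeMeasure T) :=
    (toDualVL ι ∘L ι).comp_memLp' hu.memLp
  have mdiff : MemLp (fun t => toDualV ι ((ut t - ud t : Vt) : H)) 2 (timeMeasure T) :=
    (toDualVL ι ∘L Vt.subtypeL).comp_memLp' hdiff.memLp
  have mdiff' : MemLp (fun t => toDualV ι ((ut' t - ud' t : Vt) : H)) 2 (timeMeasure T) :=
    (toDualVL ι ∘L Vt.subtypeL).comp_memLp' hdiff.memLp_deriv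
  have hz' : MemLp z' 2 (timeMeasure T) := hu'.sub mdiff'
  have hdz : IsWeakDeriv T (fun t => toDualV ι (ι (ec t))) z' := by
    have h1 : IsWeakDeriv T (fun t => toDualV ι ((ut t - ud t : Vt) : H))
        (fun t => toDualV ι ((ut' t - ud' t : Vt) : H)) :=
      hdiff.isWeakDeriv.clm_comp (toDualVL ι ∘L Vt.subtypeL) hdiff.memLp.integrable_timeMeasure
        hdiff.memLp_deriv.integrable_timeMeasure
    refine (hud'.sub h1 mι.integrable_timeMeasure hu'.integrable_timeMeasure
      mdiff.integrable_timeMeasure mdiff'.integrable_timeMeasure).congr_left ?_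
    filter_upwards [hdecι] with t ht
    simp only [ec]
    rw [ht, map_sub, ← toDualVL_apply, ← toDualVL_apply, ← toDualVL_apply, map_sub]
  have henergy := neg_norm_sq_le_integral hT ι hec hz' hdz hw hwec
  -- the energy estimate
  let X : ℝ → ℝ := fun t => γ * (p (ε t) + p (inclVt ι Vt (ud t))) + dualNorm ι Vt p (ud' t)
    + embeddingConst ι Vt p * ‖R t‖
  have mX : MemLp X 2 (timeMeasure T) :=
    (((mε.add md).const_mul γ).add mdual).add (mR.const_mul _)
  -- Young's inequality `2 X q ≤ X² + q²`, with `q` the energy norm of `e^c`, absorbs one of the two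
  -- copies of `q²`.
  have hpoint : ∀ᵐ t ∂timeMeasure T,
      2 * z' t (ec t) + p (inclV ι Vt (ec t)) ^ 2 ≤ X t ^ 2 := by
    filter_upwards [hueq, hdec] with t h1 h2
    have := error_equation_le hE (y' := ut' t) (d' := ud' t) h1 h2
    change z' t (ec t) + p (inclV ι Vt (ec t)) ^ 2 ≤ X t * p (inclV ι Vt (ec t)) at this
    nlinarith [sq_nonneg (X t - p (inclV ι Vt (ec t)))]
  have iz : Integrable (fun t => z' t (ec t)) (timeMeasure T) :=
    memLp_one_iff_integrable.1 (memLp_one_apply hz' hec)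
  have hint := integral_mono_ae ((iz.const_mul 2).add mz.integrable_sq) mX.integrable_sq hpoint
  simp only [Pi.add_apply] at hint
  rw [integral_add (iz.const_mul 2) mz.integrable_sq, integral_const_mul] at hint
  have hz2 : l2Norm T (fun t => p (inclV ι Vt (ec t))) ≤ ENNReal.ofReal ‖w 0‖ + l2Norm T X :=
    eLpNorm_two_le_add mz mX (norm_nonneg _) (by linarith)
  have hX : l2Norm T X ≤ ENNReal.ofReal γ * (l2Norm T (fun t => p (ε t))
      + l2Norm T (fun t => p (inclVt ι Vt (ud t)))) + l2Norm T (fun t => dualNorm ι Vt p (ud' t))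
      + ENNReal.ofReal (embeddingConst ι Vt p) * l2Norm T (fun t => ‖R t‖) := by
    refine (eLpNorm_add_le (((mε.add md).const_mul γ).add mdual).1 (mR.const_mul _).1
      one_le_two).trans (add_le_add ?_ (eLpNorm_const_mul_of_nonneg hb0 _).le)
    refine (eLpNorm_add_le ((mε.add md).const_mul γ).1 mdual.1 one_le_two).trans
      (add_le_add ?_ le_rfl)
    refine (eLpNorm_const_mul_of_nonneg hγ0 _).le.trans (mul_le_mul_right ?_ _)
    exact eLpNorm_add_le mε.1 md.1 one_le_two
  have he : l2Norm T (fun t => p (e t)) ≤ l2Norm T (fun t => p (inclV ι Vt (ec t)))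
      + l2Norm T (fun t => p (inclVt ι Vt (ud t))) := by
    refine (eLpNorm_mono_ae_real (g := fun t => p (inclV ι Vt (ec t)) + p (inclVt ι Vt (ud t)))
      ?_).trans (eLpNorm_add_le mz.1 md.1 one_le_two)
    filter_upwards [hdec] with t ht
    have : e t = inclV ι Vt (ec t) - inclVt ι Vt (ud t) := by
      apply Subtype.ext
      simp only [e, ec]
      push_cast
      rw [coe_inclV, coe_inclV, coe_inclVt, coe_inclVt, ht, map_sub]
      abel
    rw [Real.norm_of_nonneg (apply_nonneg p _), this]
    exact map_sub_le_add p _ _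
  -- `3γ² + 2 - (γ + 1)² = (γ - 1)² + γ² ≥ 0`.
  have hC1 : γ + 1 ≤ C := Real.le_sqrt_of_sq_le (by nlinarith [sq_nonneg (γ - 1), sq_nonneg γ])
  have hC0 : 0 ≤ C := Real.sqrt_nonneg _
  have hCd : ENNReal.ofReal γ + 1 ≤ ENNReal.ofReal C := by
    rw [← ENNReal.ofReal_one, ← ENNReal.ofReal_add hγ0 zero_le_one]
    exact ENNReal.ofReal_le_ofReal hC1
  have hCε : ENNReal.ofReal γ ≤ ENNReal.ofReal (C + 1) := ENNReal.ofReal_le_ofReal (by linarith)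
  have hCb : ENNReal.ofReal (embeddingConst ι Vt p) ≤ ENNReal.ofReal (2 * embeddingConst ι Vt p) :=
    ENNReal.ofReal_le_ofReal (by linarith)
  calc l2Norm T (fun t => p (e t))
      ≤ ENNReal.ofReal ‖w 0‖ + (ENNReal.ofReal γ * (l2Norm T (fun t => p (ε t))
          + l2Norm T (fun t => p (inclVt ι Vt (ud t))))
          + l2Norm T (fun t => dualNorm ι Vt p (ud' t))
          + ENNReal.ofReal (embeddingConst ι Vt p) * l2Norm T (fun t => ‖R t‖))
        + l2Norm T (fun t => p (inclVt ι Vt (ud t))) :=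
        he.trans (add_le_add (hz2.trans (add_le_add le_rfl hX)) le_rfl)
    _ = ENNReal.ofReal ‖w 0‖ + 1 * l2Norm T (fun t => dualNorm ι Vt p (ud' t))
        + ENNReal.ofReal γ * l2Norm T (fun t => p (ε t))
        + (ENNReal.ofReal γ + 1) * l2Norm T (fun t => p (inclVt ι Vt (ud t)))
        + ENNReal.ofReal (embeddingConst ι Vt p) * l2Norm T (fun t => ‖R t‖) := by ring
    -- The argument gives the smaller constants `1`, `γ`, `γ + 1` and `C_{H,V}^b`, which are now
    -- enlarged to the stated ones.
    _ ≤ _ := by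
        gcongr
        exact one_le_two
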